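/- Let $m,p,q\in\mathbb{N}$ with $m\ge q$. Let $\mathcal S\subseteq\mathbb{C}^{p+q}$ be nonempty and put $\mathcal S\ominus\mathcal S=\{u-v : u,v\in\mathcal S\}$. For a nonempty set $\mathcal U\subseteq\mathbb{C}^{n}$ and $\rho>0$, let $N_{\mathcal U}(\rho)$ be the least number of open Euclidean balls of radius $\rho$ with centers in $\mathcal U$ that cover $\mathcal U$ (with $N_{\mathcal U}(\rho)=\infty$ if no finite number suffices), let $$\underline{\dim}_{\mathrm B}(\mathcal U)=\liminf_{\rho\to0^+}\frac{\log N_{\mathcal U}(\rho)}{\log(1/\rho)},$$ and let the lower modified Minkowski dimension be $$\underline{\dim}_{\mathrm{MB}}(\mathcal U)=\inf\Big\{\sup_{i\in\mathbb N}\underline{\dim}_{\mathrm B}(\mathcal U_i) : \mathcal U\subseteq\bigcup_{i\in\mathbb N}\mathcal U_i\Big\},$$ where the infimum is over all coverings of $\mathcal U$ by sequences of nonempty compact sets $\mathcal U_i\subseteq\mathbb{C}^n$. Suppose that $\underline{\dim}_{\mathrm{MB}}(\mathcal S\ominus\mathcal S)<2m$, and let $B\in\mathbb{C}^{m\times q}$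 be a matrix of full rank. Then, for Lebesgue-almost all $A\in\mathbb{C}^{m\times p}$, the matrix $[A\ B]\in\mathbb{C}^{m\times(p+q)}$ is one-to-one on $\mathcal S$, i.e., $[A\ B]u\neq[A\ B]v$ for all distinct $u,v\in\mathcal S$. -/

import Mathlib

open Set Filter Topology MeasureTheory
open scoped ENNReal Pointwise Matrix

noncomputable section

/-- The covering number `N_U(ρ)`: the least number of open balls of radius `ρ` centred at points
of `U` that cover `U`, with value `⊤` if no finite family of such balls covers `U`. -/
def coveringNumberBall {E : Type*} [PseudoMetricSpace E] (U : Set E) (ρ : ℝ) : ℕ∞ :=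
  sInf {n : ℕ∞ | ∃ k : ℕ, n = k ∧
    ∃ u : Fin k → E, (∀ i, u i ∈ U) ∧ U ⊆ ⋃ i, Metric.ball (u i) ρ}

/-- The lower Minkowski (box-counting) dimension
`liminf_{ρ → 0+} log N_U(ρ) / log (1/ρ)`, as an extended real number. -/
def lowerMinkowskiDim {E : Type*} [PseudoMetricSpace E] (U : Set E) : EReal :=
  liminf (fun ρ : ℝ =>
    ENNReal.log (coveringNumberBall U ρ : ℝ≥0∞) / ((Real.log (1 / ρ) : ℝ) : EReal)) (𝓝[>] 0)

/-- The lower modified Minkowski dimension: the infimum, over all countable coverings of `U` by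
nonempty compact sets, of the supremum of the lower Minkowski dimensions of the covering sets. -/
def lowerModifiedMinkowskiDim {E : Type*} [PseudoMetricSpace E] (U : Set E) : EReal :=
  sInf {d : EReal | ∃ V : ℕ → Set E,
    (∀ i, (V i).Nonempty ∧ IsCompact (V i)) ∧ U ⊆ ⋃ i, V i ∧ d = ⨆ i, lowerMinkowskiDim (V i)}

end

open scoped NNReal

/-!
Measure the matrices `A` by a product of copies of a measure that gives balls of radius `r` mass
`O(r ^ d)`; Lebesgue measure on `ℂ` is such a measure with `d = 2`. Restrict to bounded `A`, and fix
`x` whose first block has a coordinate bounded away from zero. Each coordinate of `[A B] x` is at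
most `δ` in norm on a set of measure `O(δ ^ d)`, and since the `m` rows are independent,
`‖[A B] x‖ ≤ δ` holds on a set of measure `O(δ ^ (m * d))`. If `[A B]` kills some such `x` in `U`,
it is of size `O(ρ)` at every point within `2 * ρ` of `x`, hence at a point depending only on which
of the `N_U(ρ)` balls covering `U` contains `x`. So the set of these `A` has measure
`O(N_U(ρ) * ρ ^ (m * d))`, which tends to zero along a sequence of radii as soon as the lower
Minkowski dimension of `U` is less than `m * d`. Countable unions replace the lower Minkowski
dimension by its modified version and remove the bounds. A nonzero vector of `S - S` whose first
block vanishes is not killed because `B` is injective.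
-/

section CoveringNumber

variable {E : Type*} [PseudoMetricSpace E] {U : Set E}

theorem exists_subset_iUnion_ball_of_coveringNumberBall_ne_top {ρ : ℝ}
    (h : coveringNumberBall U ρ ≠ ⊤) :
    ∃ k : ℕ, coveringNumberBall U ρ = k ∧ ∃ u : Fin k → E, U ⊆ ⋃ i, Metric.ball (u i) ρ := by
  have hne : {n : ℕ∞ | ∃ k : ℕ, n = k ∧
      ∃ u : Fin k → E, (∀ i, u i ∈ U) ∧ U ⊆ ⋃ i, Metric.ball (u i) ρ}.Nonempty := by
    contrapose! h
    rw [coveringNumberBall, h, sInf_empty]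
  obtain ⟨k, hk, u, -, hcover⟩ := csInf_mem hne
  exact ⟨k, hk, u, hcover⟩

theorem frequently_coveringNumberBall_le_of_lowerMinkowskiDim_lt {t : ℝ}
    (h : lowerMinkowskiDim U < t) :
    ∃ᶠ ρ : ℝ in 𝓝[>] 0, (coveringNumberBall U ρ : ℝ≥0∞) ≤ ENNReal.ofReal ρ ^ (-t) := by
  have hIoo : ∀ᶠ ρ : ℝ in 𝓝[>] 0, ρ ∈ Ioo (0 : ℝ) 1 := Ioo_mem_nhdsGT one_pos
  refine ((frequently_lt_of_liminf_lt (by isBoundedDefault) h).and_eventually hIoo).mono ?_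
  rintro ρ ⟨hlt, hρ0, hρ1⟩
  have hlog : 0 < Real.log (1 / ρ) := Real.log_pos (one_lt_one_div hρ0 hρ1)
  rw [EReal.div_lt_iff (EReal.coe_pos.2 hlog) (EReal.coe_ne_top _)] at hlt
  have hpow : (t : EReal) * (Real.log (1 / ρ) : ℝ) = ENNReal.log (ENNReal.ofReal ρ ^ (-t)) := by
    rw [ENNReal.log_rpow, ENNReal.log_ofReal_of_pos hρ0, one_div, Real.log_inv,
      ← EReal.coe_mul, ← EReal.coe_mul, neg_mul_comm]
  rw [hpow, ENNReal.log_lt_log_iff] at hlt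
  exact hlt.le

end CoveringNumber

section SmallBall

variable {Ω E F : Type*} [MeasurableSpace Ω] {μ : Measure Ω} [PseudoMetricSpace E]
  [SeminormedAddCommGroup F] {U W : Set E} {f : Ω → E → F} {C : ℝ≥0}

theorem measure_exists_eq_zero_le_coveringNumberBall_mul {ρ : ℝ} {c : ℝ≥0∞}
    (hN : coveringNumberBall U ρ ≠ ⊤) (hWU : W ⊆ U) (hf : ∀ᵐ ω ∂μ, LipschitzOnWith C (f ω) W)
    (hc : ∀ x ∈ W, μ {ω | ‖f ω x‖ ≤ C * (2 * ρ)} ≤ c) :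
    μ {ω | ∃ x ∈ W, f ω x = 0} ≤ coveringNumberBall U ρ * c := by
  obtain ⟨k, hk, u, hcover⟩ := exists_subset_iUnion_ball_of_coveringNumberBall_ne_top hN
  have hsub : {ω | ∃ x ∈ W, f ω x = 0} ⊆
      ⋃ i, {ω | ∃ x ∈ W ∩ Metric.ball (u i) ρ, f ω x = 0} := by
    rintro ω ⟨x, hxW, hx⟩
    obtain ⟨i, hi⟩ := mem_iUnion.1 (hcover (hWU hxW))
    exact mem_iUnion.2 ⟨i, x, ⟨hxW, hi⟩, hx⟩
  have hpiece : ∀ i, μ {ω | ∃ x ∈ W ∩ Metric.ball (u i) ρ, f ω x = 0} ≤ c := by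
    intro i
    obtain hempty | ⟨w, hwW, hwi⟩ := (W ∩ Metric.ball (u i) ρ).eq_empty_or_nonempty
    · simp [hempty]
    · refine (measure_mono_ae ?_).trans (hc w hwW)
      filter_upwards [hf] with ω hω
      rintro ⟨x, ⟨hxW, hxi⟩, hx⟩
      have hdist : dist w x ≤ 2 * ρ := by
        linarith [dist_triangle_right w x (u i), Metric.mem_ball.1 hwi, Metric.mem_ball.1 hxi]
      calc ‖f ω w‖ = dist (f ω w) (f ω x) := by rw [hx, dist_zero_right]
        _ ≤ C * dist w x := hω.dist_le_mul w hwW x hxW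
        _ ≤ C * (2 * ρ) := by gcongr
  calc μ {ω | ∃ x ∈ W, f ω x = 0}
      ≤ ∑ i, μ {ω | ∃ x ∈ W ∩ Metric.ball (u i) ρ, f ω x = 0} :=
        (measure_mono hsub).trans (measure_iUnion_fintype_le _ _)
    _ ≤ ∑ _i : Fin k, c := Finset.sum_le_sum fun i _ => hpiece i
    _ = coveringNumberBall U ρ * c := by simp [hk]

theorem tendsto_ofReal_rpow_neg_mul_rpow_nhdsGT_zero {s t b : ℝ} (ht : t < s) (hs : 0 ≤ s)
    {K : ℝ≥0∞} (hK : K ≠ ∞) (hb : 0 ≤ b) :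
    Tendsto (fun ρ : ℝ => ENNReal.ofReal ρ ^ (-t) * (K * ENNReal.ofReal (b * ρ) ^ s))
      (𝓝[>] 0) (𝓝 0) := by
  have hpow : Tendsto (fun ρ : ℝ => ENNReal.ofReal ρ ^ (s - t)) (𝓝[>] 0) (𝓝 0) := by
    have hcont : Continuous fun ρ : ℝ => ENNReal.ofReal ρ ^ (s - t) :=
      (ENNReal.continuous_rpow_const).comp ENNReal.continuous_ofReal
    simpa [ENNReal.zero_rpow_of_pos (sub_pos.2 ht)] using
      (hcont.tendsto 0).mono_left nhdsWithin_le_nhds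
  have hmul := ENNReal.Tendsto.mul_const (b := K * ENNReal.ofReal b ^ s) hpow
    (Or.inr (by finiteness))
  rw [zero_mul] at hmul
  refine hmul.congr' ?_
  filter_upwards [self_mem_nhdsWithin] with ρ hρ
  rw [ENNReal.ofReal_mul hb, ENNReal.mul_rpow_of_nonneg _ _ hs, sub_eq_neg_add,
    ENNReal.rpow_add _ _ (ENNReal.ofReal_pos.2 hρ).ne' ENNReal.ofReal_ne_top]
  ring

theorem ae_forall_ne_zero_of_lowerMinkowskiDim_lt {s : ℝ≥0} {K : ℝ≥0∞} (hK : K ≠ ∞)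
    (hU : lowerMinkowskiDim U < (s : ℝ)) (hWU : W ⊆ U)
    (hf : ∀ᵐ ω ∂μ, LipschitzOnWith C (f ω) W)
    (hsmall : ∀ x ∈ W, ∀ δ : ℝ, μ {ω | ‖f ω x‖ ≤ δ} ≤ K * ENNReal.ofReal δ ^ (s : ℝ)) :
    ∀ᵐ ω ∂μ, ∀ x ∈ W, f ω x ≠ 0 := by
  obtain ⟨t, hUt, hts⟩ := EReal.lt_iff_exists_real_btwn.1 hU
  have hlim := tendsto_ofReal_rpow_neg_mul_rpow_nhdsGT_zero (EReal.coe_lt_coe_iff.1 hts)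
    s.coe_nonneg hK (b := C * 2) (by positivity)
  have hbound : ∃ᶠ ρ : ℝ in 𝓝[>] 0, μ {ω | ∃ x ∈ W, f ω x = 0} ≤
      ENNReal.ofReal ρ ^ (-t) * (K * ENNReal.ofReal (C * 2 * ρ) ^ (s : ℝ)) := by
    refine ((frequently_coveringNumberBall_le_of_lowerMinkowskiDim_lt hUt).and_eventually
      self_mem_nhdsWithin).mono ?_
    rintro ρ ⟨hNρ, hρ⟩
    have hρ' : ENNReal.ofReal ρ ≠ 0 := (ENNReal.ofReal_pos.2 hρ).ne'
    have hN : coveringNumberBall U ρ ≠ ⊤ := by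
      intro htop
      rw [htop, ENat.toENNReal_top, top_le_iff] at hNρ
      exact ENNReal.rpow_ne_top_of_ne_zero hρ' ENNReal.ofReal_ne_top hNρ
    refine (measure_exists_eq_zero_le_coveringNumberBall_mul hN hWU hf fun x hx => ?_).trans
      (mul_le_mul_left hNρ _)
    rw [← mul_assoc]
    exact hsmall x hx _
  have hnull : μ {ω | ∃ x ∈ W, f ω x = 0} = 0 :=
    nonpos_iff_eq_zero.1 (ge_of_tendsto_of_frequently hlim hbound)
  simpa [ae_iff] using hnull

end SmallBall

/-- Upper regularity of exponent `d` (the Frostman condition): balls of radius `r` have mass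
`O(r ^ d)`, uniformly in the centre. It is required at every scale, not only for small `r`, so that
it also makes every ball have finite mass. -/
def IsUpperRegular {X : Type*} [PseudoMetricSpace X] [MeasurableSpace X] (ν : Measure X)
    (d : ℝ≥0) : Prop :=
  ∃ K : ℝ≥0∞, K ≠ ∞ ∧
    ∀ (x : X) (r : ℝ), ν (Metric.closedBall x r) ≤ K * ENNReal.ofReal r ^ (d : ℝ)

namespace IsUpperRegular

variable {X : Type*} [PseudoMetricSpace X] [MeasurableSpace X] {ν : Measure X} {d : ℝ≥0}

theorem restrict (hν : IsUpperRegular ν d) (s : Set X) : IsUpperRegular (ν.restrict s) d := by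
  obtain ⟨K, hK, hball⟩ := hν
  exact ⟨K, hK, fun x r => (Measure.restrict_le_self _).trans (hball x r)⟩

theorem measure_closedBall_lt_top (hν : IsUpperRegular ν d) (x : X) (r : ℝ) :
    ν (Metric.closedBall x r) < ∞ := by
  obtain ⟨K, hK, hball⟩ := hν
  exact (hball x r).trans_lt (by finiteness)

end IsUpperRegular

theorem isUpperRegular_volume_complex : IsUpperRegular (volume : Measure ℂ) 2 :=
  ⟨NNReal.pi, ENNReal.coe_ne_top, fun x r => by
    rw [Complex.volume_closedBall, mul_comm, NNReal.coe_ofNat, ENNReal.rpow_ofNat]⟩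

section PiMeasure

variable {ι : Type*} [Fintype ι]

theorem pi_le_mul_prod_of_forall_update [DecidableEq ι] {X : ι → Type*}
    [∀ i, MeasurableSpace (X i)] (μ : ∀ i, Measure (X i)) [∀ i, SigmaFinite (μ i)]
    {s : Set (∀ i, X i)} (hs : MeasurableSet s) (j : ι) {c : ℝ≥0∞}
    (hc : ∀ a, μ j {x | Function.update a j x ∈ s} ≤ c) :
    Measure.pi μ s ≤ c * ∏ i ∈ Finset.univ.erase j, μ i univ := by
  obtain hempty | ⟨a, -⟩ := s.eq_empty_or_nonempty
  · simp [hempty]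
  have hslice (a : ∀ i, X i) : ∫⁻ x, s.indicator 1 (Function.update a j x) ∂μ j ≤ c := by
    have hpre : MeasurableSet {x | Function.update a j x ∈ s} := measurable_update a hs
    exact (lintegral_indicator_one hpre).le.trans (hc a)
  calc Measure.pi μ s
      = (∫⋯∫⁻_Finset.univ, s.indicator 1 ∂μ) a := by
        rw [← lintegral_indicator_one hs, lintegral_eq_lmarginal_univ a]
    _ = (∫⋯∫⁻_Finset.univ.erase j,
          (fun a => ∫⁻ x, s.indicator 1 (Function.update a j x) ∂μ j) ∂μ) a := by
        rw [lmarginal_erase' _ (measurable_one.indicator hs) (Finset.mem_univ j)]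
    _ ≤ (∫⋯∫⁻_Finset.univ.erase j, (fun _ => c) ∂μ) a := lmarginal_mono hslice a
    _ = c * ∏ i ∈ Finset.univ.erase j, μ i univ := by
        rw [lmarginal, lintegral_const, Measure.pi_univ,
          Finset.prod_coe_sort _ fun i => μ i univ]

theorem pi_restrict_closedBall {X : ι → Type*} [∀ i, PseudoMetricSpace (X i)]
    [∀ i, MeasurableSpace (X i)] (μ : ∀ i, Measure (X i)) [∀ i, SigmaFinite (μ i)]
    (x : ∀ i, X i) {r : ℝ} (hr : 0 ≤ r) :
    (Measure.pi μ).restrict (Metric.closedBall x r) =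
      Measure.pi fun i => (μ i).restrict (Metric.closedBall (x i) r) := by
  rw [closedBall_pi x hr, Measure.restrict_pi_pi]

end PiMeasure

section Matrix

variable {m ι κ : Type*} [Fintype ι] [Fintype κ]

theorem mulVec_injective_of_rank_eq_card {F : Type*} [Field F] {B : Matrix m κ F}
    (hB : B.rank = Fintype.card κ) : Function.Injective B.mulVec := by
  rw [Matrix.mulVec_injective_iff, linearIndependent_iff_card_eq_finrank_span, Set.finrank,
    ← Matrix.rank_eq_finrank_span_cols, hB]

theorem comp_inl_ne_zero_of_fromCols_mulVec_eq_zero {R : Type*} [Semiring R] {A : Matrix m ι R}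
    {B : Matrix m κ R} (hB : Function.Injective B.mulVec) {x : ι ⊕ κ → R} (hx : x ≠ 0)
    (hAB : Matrix.fromCols A B *ᵥ x = 0) : x ∘ Sum.inl ≠ 0 := by
  intro hinl
  have hinr : x ∘ Sum.inr = 0 := by
    rw [Matrix.fromCols_mulVec, hinl, Matrix.mulVec_zero, zero_add] at hAB
    exact hB (hAB.trans (Matrix.mulVec_zero B).symm)
  exact hx (funext (Sum.rec (congrFun hinl) (congrFun hinr)))

variable {R : Type*} [NonUnitalSeminormedRing R] [Fintype m]

theorem lipschitzWith_mulVec_of_nnnorm_entry_le {M : Matrix m ι R} {b : ℝ≥0}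
    (hM : ∀ i j, ‖M i j‖₊ ≤ b) : LipschitzWith (Fintype.card ι * b) M.mulVec := by
  refine LipschitzWith.of_dist_le_mul fun v w => ?_
  rw [dist_eq_norm, dist_eq_norm, ← Matrix.mulVec_sub, pi_norm_le_iff_of_nonneg (by positivity)]
  intro i
  calc ‖∑ j, M i j * (v - w) j‖ ≤ ∑ _j : ι, b * ‖v - w‖ :=
        norm_sum_le_of_le _ fun j _ =>
          (norm_mul_le _ _).trans <|
            mul_le_mul (hM i j) (norm_le_pi_norm _ j) (norm_nonneg _) b.coe_nonneg
    _ = (Fintype.card ι * b : ℝ≥0) * ‖v - w‖ := by simp [mul_assoc]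

theorem exists_lipschitzWith_fromCols_mulVec (B : Matrix m κ R) (r : ℝ≥0) :
    ∃ C : ℝ≥0, ∀ A : m → ι → R, ‖A‖ ≤ r → LipschitzWith C
      fun x : EuclideanSpace R (ι ⊕ κ) => Matrix.fromCols (Matrix.of A) B *ᵥ x.ofLp := by
  set b : ℝ≥0 := max r ‖fun i j => B i j‖₊
  refine ⟨Fintype.card (ι ⊕ κ) * b * 1, fun A hA => ?_⟩
  refine (lipschitzWith_mulVec_of_nnnorm_entry_le ?_).comp (PiLp.lipschitzWith_ofLp 2 _)
  rintro i (j | j)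
  · exact le_max_of_le_left
      ((nnnorm_le_pi_nnnorm (A i) j).trans ((nnnorm_le_pi_nnnorm A i).trans hA))
  · exact le_max_of_le_right ((nnnorm_le_pi_nnnorm (fun j => B i j) j).trans
      (nnnorm_le_pi_nnnorm (fun i j => B i j) i))

end Matrix

section RandomMatrix

variable {𝕜 m ι κ : Type*} [NormedDivisionRing 𝕜] [Fintype m] [Fintype ι] [Fintype κ]
  [SecondCountableTopology 𝕜] [MeasurableSpace 𝕜] [OpensMeasurableSpace 𝕜]
  {ν : Measure 𝕜} {d : ℝ≥0}

theorem pi_norm_dotProduct_add_le [SigmaFinite ν] {K : ℝ≥0∞}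
    (hK : ∀ x r, ν (Metric.closedBall x r) ≤ K * ENNReal.ofReal r ^ (d : ℝ))
    {y : ι → 𝕜} {j : ι} (hy : y j ≠ 0) (e : 𝕜) (δ : ℝ) :
    Measure.pi (fun _ : ι => ν) {a | ‖a ⬝ᵥ y + e‖ ≤ δ} ≤
      K * ENNReal.ofReal (δ / ‖y j‖) ^ (d : ℝ) * ν univ ^ (Fintype.card ι - 1) := by
  classical
  have hclosed : IsClosed {a : ι → 𝕜 | ‖a ⬝ᵥ y + e‖ ≤ δ} :=
    isClosed_le (by simp only [dotProduct]; fun_prop) continuous_const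
  have hslice (a : ι → 𝕜) : ν {x | Function.update a j x ∈ {a | ‖a ⬝ᵥ y + e‖ ≤ δ}} ≤
      K * ENNReal.ofReal (δ / ‖y j‖) ^ (d : ℝ) := by
    set e' : 𝕜 := ∑ i ∈ Finset.univ.erase j, a i * y i + e
    have hsplit (x : 𝕜) : Function.update a j x ⬝ᵥ y + e = (x - -e' / y j) * y j := by
      have hrest : ∑ i ∈ Finset.univ.erase j, Function.update a j x i * y i =
          ∑ i ∈ Finset.univ.erase j, a i * y i :=
        Finset.sum_congr rfl fun i hi => by
          rw [Function.update_of_ne (Finset.ne_of_mem_erase hi)]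
      rw [dotProduct, ← Finset.add_sum_erase _ _ (Finset.mem_univ j), hrest,
        Function.update_self, sub_mul, div_mul_cancel₀ _ hy, sub_neg_eq_add, add_assoc]
    refine (measure_mono fun x hx => ?_).trans (hK (-e' / y j) (δ / ‖y j‖))
    rw [mem_closedBall_iff_norm, le_div_iff₀ (norm_pos_iff.2 hy), ← norm_mul, ← hsplit]
    exact hx
  simpa using pi_le_mul_prod_of_forall_update (fun _ : ι => ν) hclosed.measurableSet j hslice

theorem pi_norm_dotProduct_add_le_of_le_norm [SigmaFinite ν] {K : ℝ≥0∞}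
    (hK : ∀ x r, ν (Metric.closedBall x r) ≤ K * ENNReal.ofReal r ^ (d : ℝ))
    {y : ι → 𝕜} {j : ι} {η : ℝ} (hη : 0 < η) (hy : η ≤ ‖y j‖) (e : 𝕜) (δ : ℝ) :
    Measure.pi (fun _ : ι => ν) {a | ‖a ⬝ᵥ y + e‖ ≤ δ} ≤
      K * ENNReal.ofReal η⁻¹ ^ (d : ℝ) * ν univ ^ (Fintype.card ι - 1) *
        ENNReal.ofReal δ ^ (d : ℝ) := by
  obtain hδ | hδ := lt_or_ge δ 0
  · simp [fun a : 𝕜 => (hδ.trans_le (norm_nonneg a)).not_ge]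
  calc Measure.pi (fun _ : ι => ν) {a | ‖a ⬝ᵥ y + e‖ ≤ δ}
      ≤ K * ENNReal.ofReal (δ / ‖y j‖) ^ (d : ℝ) * ν univ ^ (Fintype.card ι - 1) :=
        pi_norm_dotProduct_add_le hK (norm_pos_iff.1 (hη.trans_le hy)) e δ
    _ ≤ K * ENNReal.ofReal (η⁻¹ * δ) ^ (d : ℝ) * ν univ ^ (Fintype.card ι - 1) := by
        rw [inv_mul_eq_div]
        gcongr
    _ = _ := by
        rw [ENNReal.ofReal_mul (by positivity), ENNReal.mul_rpow_of_nonneg _ _ d.coe_nonneg]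
        ring

theorem pi_pi_norm_fromCols_mulVec_le [SigmaFinite ν] {K : ℝ≥0∞}
    (hK : ∀ x r, ν (Metric.closedBall x r) ≤ K * ENNReal.ofReal r ^ (d : ℝ))
    {x : ι ⊕ κ → 𝕜} {j : ι} {η : ℝ} (hη : 0 < η) (hx : η ≤ ‖x (Sum.inl j)‖)
    (B : Matrix m κ 𝕜) (δ : ℝ) :
    Measure.pi (fun _ : m => Measure.pi fun _ : ι => ν)
        {A | ‖Matrix.fromCols (Matrix.of A) B *ᵥ x‖ ≤ δ} ≤
      (K * ENNReal.ofReal η⁻¹ ^ (d : ℝ) * ν univ ^ (Fintype.card ι - 1)) ^ Fintype.card m *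
        ENNReal.ofReal δ ^ ((Fintype.card m * d : ℝ≥0) : ℝ) := by
  set slab : m → Set (ι → 𝕜) := fun i =>
    {a | ‖a ⬝ᵥ (x ∘ Sum.inl) + (B *ᵥ (x ∘ Sum.inr)) i‖ ≤ δ}
  have hsub : {A : m → ι → 𝕜 | ‖Matrix.fromCols (Matrix.of A) B *ᵥ x‖ ≤ δ} ⊆ univ.pi slab := by
    intro A hA i _
    rw [mem_ofPred_eq, Matrix.fromCols_mulVec] at hA
    exact (norm_le_pi_norm _ i).trans hA
  calc Measure.pi (fun _ : m => Measure.pi fun _ : ι => ν)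
        {A | ‖Matrix.fromCols (Matrix.of A) B *ᵥ x‖ ≤ δ}
      ≤ ∏ i, Measure.pi (fun _ : ι => ν) (slab i) :=
        (measure_mono hsub).trans_eq (Measure.pi_pi _ _)
    _ ≤ ∏ _i : m, (K * ENNReal.ofReal η⁻¹ ^ (d : ℝ) * ν univ ^ (Fintype.card ι - 1) *
          ENNReal.ofReal δ ^ (d : ℝ)) :=
        Finset.prod_le_prod' fun i _ =>
          pi_norm_dotProduct_add_le_of_le_norm hK (y := x ∘ Sum.inl) hη hx _ δ
    _ = _ := by
        rw [Finset.prod_const, Finset.card_univ, mul_pow, ← ENNReal.rpow_mul_natCast,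
          mul_comm (d : ℝ), NNReal.coe_mul, NNReal.coe_natCast]

variable [SigmaFinite ν]

theorem ae_restrict_closedBall_fromCols_mulVec_ne_zero (hν : IsUpperRegular ν d)
    {U : Set (EuclideanSpace 𝕜 (ι ⊕ κ))}
    (hU : lowerMinkowskiDim U < ((Fintype.card m * d : ℝ≥0) : ℝ)) (B : Matrix m κ 𝕜)
    (R : ℝ≥0) (j : ι) {η : ℝ} (hη : 0 < η) :
    ∀ᵐ A ∂(Measure.pi fun _ : m => Measure.pi fun _ : ι => ν).restrict (Metric.closedBall 0 R),
      ∀ x ∈ {x ∈ U | η ≤ ‖x (Sum.inl j)‖}, Matrix.fromCols (Matrix.of A) B *ᵥ x.ofLp ≠ 0 := by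
  obtain ⟨C, hC⟩ := exists_lipschitzWith_fromCols_mulVec (ι := ι) B R
  obtain ⟨K, hKtop, hK⟩ := hν.restrict (Metric.closedBall 0 R)
  have hmass : ν (Metric.closedBall 0 R) ≠ ∞ := (hν.measure_closedBall_lt_top 0 R).ne
  have : IsFiniteMeasure (ν.restrict (Metric.closedBall 0 R)) := isFiniteMeasure_restrict.2 hmass
  refine ae_forall_ne_zero_of_lowerMinkowskiDim_lt
    (C := C)
    (f := fun A (x : EuclideanSpace 𝕜 (ι ⊕ κ)) => Matrix.fromCols (Matrix.of A) B *ᵥ x.ofLp)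
    (K := (K * ENNReal.ofReal η⁻¹ ^ (d : ℝ) *
      ν.restrict (Metric.closedBall 0 R) univ ^ (Fintype.card ι - 1)) ^ Fintype.card m)
    (by finiteness) hU (sep_subset _ _) ?_ ?_
  · filter_upwards [ae_restrict_mem measurableSet_closedBall] with A hA
    exact (hC A (mem_closedBall_zero_iff.1 hA)).lipschitzOnWith
  · intro x hx δ
    have hlaw : (Measure.pi fun _ : m => Measure.pi fun _ : ι => ν).restrict
        (Metric.closedBall 0 R) =
          Measure.pi fun _ : m => Measure.pi fun _ : ι => ν.restrict (Metric.closedBall 0 R) := by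
      simp only [pi_restrict_closedBall _ _ R.coe_nonneg, Pi.zero_apply]
    rw [hlaw]
    exact pi_pi_norm_fromCols_mulVec_le hK hη hx.2 B δ

theorem ae_fromCols_mulVec_ne_zero_of_lowerMinkowskiDim_lt (hν : IsUpperRegular ν d)
    {U : Set (EuclideanSpace 𝕜 (ι ⊕ κ))}
    (hU : lowerMinkowskiDim U < ((Fintype.card m * d : ℝ≥0) : ℝ)) (B : Matrix m κ 𝕜) :
    ∀ᵐ A ∂Measure.pi fun _ : m => Measure.pi fun _ : ι => ν,
      ∀ x ∈ U, x.ofLp ∘ Sum.inl ≠ 0 → Matrix.fromCols (Matrix.of A) B *ᵥ x.ofLp ≠ 0 := by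
  rw [← Measure.restrict_univ (μ := Measure.pi _), ← Metric.iUnion_closedBall_nat 0,
    ae_restrict_iUnion_iff]
  intro R
  have hae : ∀ᵐ A ∂(Measure.pi fun _ : m => Measure.pi fun _ : ι => ν).restrict
      (Metric.closedBall 0 R), ∀ (j : ι) (n : ℕ), ∀ x ∈ {x ∈ U | 1 / (n + 1 : ℝ) ≤ ‖x (Sum.inl j)‖},
        Matrix.fromCols (Matrix.of A) B *ᵥ x.ofLp ≠ 0 :=
    ae_all_iff.2 fun j => ae_all_iff.2 fun n =>
      ae_restrict_closedBall_fromCols_mulVec_ne_zero hν hU B R j Nat.one_div_pos_of_nat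
  filter_upwards [hae] with A hA x hx hinl
  obtain ⟨j, hj⟩ := Function.ne_iff.1 hinl
  obtain ⟨n, hn⟩ := exists_nat_one_div_lt (norm_pos_iff.2 hj)
  exact hA j n x ⟨hx, hn.le⟩

theorem ae_fromCols_mulVec_ne_zero_of_lowerModifiedMinkowskiDim_lt (hν : IsUpperRegular ν d)
    {U : Set (EuclideanSpace 𝕜 (ι ⊕ κ))}
    (hU : lowerModifiedMinkowskiDim U < ((Fintype.card m * d : ℝ≥0) : ℝ))
    {B : Matrix m κ 𝕜} (hB : Function.Injective B.mulVec) :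
    ∀ᵐ A ∂Measure.pi fun _ : m => Measure.pi fun _ : ι => ν,
      ∀ x ∈ U, x ≠ 0 → Matrix.fromCols (Matrix.of A) B *ᵥ x.ofLp ≠ 0 := by
  obtain ⟨_, ⟨V, -, hcover, rfl⟩, hV⟩ := sInf_lt_iff.1 hU
  have hae := ae_all_iff.2 fun i =>
    ae_fromCols_mulVec_ne_zero_of_lowerMinkowskiDim_lt hν
      ((le_iSup (fun i => lowerMinkowskiDim (V i)) i).trans_lt hV) B
  filter_upwards [hae] with A hA x hxU hx0 hker
  obtain ⟨i, hi⟩ := mem_iUnion.1 (hcover hxU)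
  exact hA i x hi
    (comp_inl_ne_zero_of_fromCols_mulVec_eq_zero hB ((WithLp.ofLp_eq_zero 2).not.2 hx0) hker) hker

theorem mainTheorem2_general (hν : IsUpperRegular ν d) (S : Set (EuclideanSpace 𝕜 (ι ⊕ κ)))
    (hdim : lowerModifiedMinkowskiDim (S - S) < ((Fintype.card m * d : ℝ≥0) : ℝ))
    (B : Matrix m κ 𝕜) (hB : Function.Injective B.mulVec) :
    ∀ᵐ A ∂Measure.pi fun _ : m => Measure.pi fun _ : ι => ν,
      Set.InjOn (fun x : EuclideanSpace 𝕜 (ι ⊕ κ) =>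
        Matrix.fromCols (Matrix.of A) B *ᵥ x.ofLp) S := by
  filter_upwards [ae_fromCols_mulVec_ne_zero_of_lowerModifiedMinkowskiDim_lt hν hdim hB]
    with A hA u hu v hv huv
  by_contra hne
  refine hA (u - v) (sub_mem_sub hu hv) (sub_ne_zero.2 hne) ?_
  rw [WithLp.ofLp_sub, Matrix.mulVec_sub]
  exact sub_eq_zero.2 huv

end RandomMatrix

theorem mainTheorem2 (m p q : ℕ) (hqm : q ≤ m)
    (S : Set (EuclideanSpace ℂ (Fin p ⊕ Fin q))) (hS : S.Nonempty)
    (hdim : lowerModifiedMinkowskiDim (S - S) < ((2 * m : ℕ) : EReal))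
    (B : Matrix (Fin m) (Fin q) ℂ) (hB : B.rank = min m q) :
    ∀ᵐ A : Fin m → Fin p → ℂ,
      Set.InjOn (fun x : EuclideanSpace ℂ (Fin p ⊕ Fin q) =>
        Matrix.fromCols (Matrix.of A) B *ᵥ x.ofLp) S :=
  mainTheorem2_general isUpperRegular_volume_complex S
    (by rw [Fintype.card_fin, mul_comm]; exact_mod_cast hdim) B
    (mulVec_injective_of_rank_eq_card (by simpa [hqm] using hB))
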